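/- For square $\{\pm1\}$-matrices $A,B,C,D$ of order $n$ the \emph{GP array} is the $4n\times 4n$ matrix $$GP(A,B,C,D)=\begin{pmatrix} A & BR & CR & DR\\ CR & D^TR & -A & -B^TR\\ BR & -A & -D^TR & C^TR\\ DR & -C^TR & B^TR & -A\end{pmatrix},$$ where $R$ is the back-diagonal matrix obtained from the identity matrix $I_n$ by reversing the order of its rows. Let $q=4n-1$ be a prime power with $q\equiv 3 \pmod 8$. Then there exist four circulant $\{\pm1\}$-matrices $A,B,C,D$ of order $n$ such that $$AA^T+BB^T+CC^T+DD^T=4nI_n,\qquad (I_n-A)^T=-I_n+A,\qquad B^T=B,\qquad C=D,$$ and for which the matrix $GP(B,C,D,A)$, obtained by plugging the permuted quadruple $[B,C,D,A]$ into the GP array, is a symmetric Hadamard matrix of order $4n$ (that is, $H=GP(B,C,D,A)$ has entries $\pm1$, $H^T=H$ and $HH^T=H^TH=4nI_{4n}$). In particular, there exists a symmetric Hadamard matrix of order $4n$ of GP-type. -/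

import Mathlib

open scoped Matrix

/-- The back-diagonal matrix `R`, obtained from the identity matrix of order `n` by reversing the
order of its rows. -/
def backDiagonal (n : ℕ) : Matrix (Fin n) (Fin n) ℤ :=
  (1 : Matrix (Fin n) (Fin n) ℤ).submatrix Fin.rev id

/-- The GP array of Balonin and Seberry: the `4n × 4n` matrix obtained by plugging four
`n × n` blocks into a `4 × 4` array. Row `n * a + i` is row `i` of the block row `a`. -/
def gpArray {n : ℕ} (A B C D : Matrix (Fin n) (Fin n) ℤ) :
    Matrix (Fin (4 * n)) (Fin (4 * n)) ℤ :=
  let R := backDiagonal n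
  let blocks : Matrix (Fin 4) (Fin 4) (Matrix (Fin n) (Fin n) ℤ) :=
    !![A,     B * R,      C * R,      D * R;
       C * R, Dᵀ * R,     -A,         -(Bᵀ * R);
       B * R, -A,         -(Dᵀ * R),  Cᵀ * R;
       D * R, -(Cᵀ * R),  Bᵀ * R,     -A]
  Matrix.reindex finProdFinEquiv finProdFinEquiv (Matrix.comp (Fin 4) (Fin 4) (Fin n) (Fin n) ℤ blocks)

/-- A binary circulant: a circulant matrix all of whose entries are `1` or `-1`. -/
def IsBinaryCirculant {n : ℕ} (A : Matrix (Fin n) (Fin n) ℤ) : Prop :=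
  ∃ a : Fin n → ℤ, (∀ i, a i = 1 ∨ a i = -1) ∧ A = Matrix.circulant a

/-- Four binary circulants of order `n` with `AAᵀ + BBᵀ + CCᵀ + DDᵀ = 4n I`, i.e. a quadruple
that the Goethals-Seidel array turns into a Hadamard matrix of order `4n`. -/
structure IsGoethalsSeidelQuadruple {n : ℕ} (A B C D : Matrix (Fin n) (Fin n) ℤ) : Prop where
  circulant_A : IsBinaryCirculant A
  circulant_B : IsBinaryCirculant B
  circulant_C : IsBinaryCirculant C
  circulant_D : IsBinaryCirculant D
  sum_mul_transpose :
    A * Aᵀ + B * Bᵀ + C * Cᵀ + D * Dᵀ = (4 * n : ℤ) • (1 : Matrix (Fin n) (Fin n) ℤ)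

/-- Propus matrices: a quadruple as above with `A` symmetric and `B = C`. -/
structure IsPropusQuadruple {n : ℕ} (A B C D : Matrix (Fin n) (Fin n) ℤ) : Prop extends
    IsGoethalsSeidelQuadruple A B C D where
  symm_A : Aᵀ = A
  B_eq_C : B = C

/-!
Let `K` be the field with `q = 4n - 1` elements, `L` its quadratic extension, `g` a generator of
`Lˣ` and `χ` the quadratic character of `K`. The quadruple is read off the sequence
`v i = χ (Tr (g ^ (i + 2n)))`.

Since `g ^ (q + 1)` is a nonsquare of `K`, the sequence satisfies `v (i + 4n) = -v i`, and
invariance of the trace under the Frobenius turns into `v (-i) = -(-1) ^ i * v i`. A nonzero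
element of trace zero is determined up to `Kˣ`; its position is `i = 0`, so `v` vanishes exactly at the
multiples of `4n`. For `a ∉ K` the map `x ↦ (Tr x, Tr (a x))` is a bijection `L → K × K`
(`trace_prod_bijective`), so `∑ χ (Tr x) * χ (Tr (a x)) = 0`: this says that the autocorrelations
of `v` vanish at all shifts not divisible by `4n` (`sum_traceSeq_mul`).

As `q ≡ 3 [MOD 8]`, `n` is odd, and the exponents modulo `4n` can be written as `8k + nj` with
`k` modulo `n` and `j < 4`. This splits `v` into four circulants `X₀, X₁, X₂, X₃` of order `n`. The
reflection rule gives `X₀ᵀ = -X₀`, `X₂ᵀ = X₂` and `X₁ᵀ = -X₃`, and the only zeros are on the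
diagonal of `X₀`. The autocorrelation identity makes `∑ Xⱼ Xⱼᵀ` diagonal. As `X₁ X₁ᵀ = X₃ X₃ᵀ`, the quadruple
`A = 1 + X₀`, `B = X₂`, `C = D = X₁` has the required properties
(`IsTraceSequence.exists_quadruple`).

Finally, the back-diagonal matrix `R` satisfies `R X = Xᵀ R` for circulants `X`, and circulants
commute. With a symmetric first member and equal second and third members, these relations make the
GP array symmetric and all cross terms of its square cancel (`gpPattern_mul_self`,
`IsPropusQuadruple.gpArray_isHadamard_and_isSymm`).
-/

theorem Odd.isCoprime_natCast_eight {n : ℕ} (hn : Odd n) : IsCoprime (n : ℤ) 8 := by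
  have := (Nat.coprime_two_right.2 hn).pow_right 3
  exact_mod_cast Nat.isCoprime_iff_coprime.2 this

/-! ### The trace sequence of a quadratic extension of finite fields -/

section QuadraticExtension

variable {K L : Type*} [Field K] [Fintype K] [Field L] [Algebra K L]

theorem quadraticChar_trace_smul [DecidableEq K] (c : K) (x : L) :
    quadraticChar K (Algebra.trace K L (c • x)) =
      quadraticChar K c * quadraticChar K (Algebra.trace K L x) := by
  rw [map_smul, smul_eq_mul, map_mul]

/-- The values of the quadratic character of `K` at the traces of the powers of `g`. When `g`
generates `Lˣ` and `L` is quadratic over `K` with `q` elements, this is a sequence on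
`Lˣ / Kˣ ≃ ℤ / (q + 1)` up to sign. -/
noncomputable def traceSeq (K : Type*) {L : Type*} [Field K] [Fintype K] [DecidableEq K] [Field L]
    [Algebra K L] (g : Lˣ) (i : ℤ) : ℤ :=
  quadraticChar K (Algebra.trace K L ((g ^ i : Lˣ) : L))

theorem traceSeq_ne_zero_dichotomy [DecidableEq K] {g : Lˣ} {i : ℤ} (hi : traceSeq K g i ≠ 0) :
    traceSeq K g i = 1 ∨ traceSeq K g i = -1 :=
  quadraticChar_dichotomy fun h => hi (quadraticChar_eq_zero_iff.2 h)

variable [Fintype L]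

theorem algebraMap_trace_of_finrank_eq_two (h2 : Module.finrank K L = 2) (x : L) :
    algebraMap K L (Algebra.trace K L x) = x + x ^ Fintype.card K := by
  rw [FiniteField.algebraMap_trace_eq_sum_pow, h2, Nat.card_eq_fintype_card]
  simp [Finset.sum_range_succ]

theorem algebraMap_norm_of_finrank_eq_two (h2 : Module.finrank K L = 2) (x : L) :
    algebraMap K L (Algebra.norm K x) = x ^ (Fintype.card K + 1) := by
  rw [FiniteField.algebraMap_norm_eq_pow_sum, h2, Nat.card_eq_fintype_card]
  simp [Finset.sum_range_succ, add_comm]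

theorem card_eq_sq_of_finrank_eq_two (h2 : Module.finrank K L = 2) :
    Fintype.card L = Fintype.card K ^ 2 := by
  rw [Module.card_eq_pow_finrank (K := K) (V := L), h2]

theorem trace_pow_card (h2 : Module.finrank K L = 2) (x : L) :
    Algebra.trace K L (x ^ Fintype.card K) = Algebra.trace K L x := by
  apply (algebraMap K L).injective
  rw [algebraMap_trace_of_finrank_eq_two h2, algebraMap_trace_of_finrank_eq_two h2, ← pow_mul,
    ← sq, ← card_eq_sq_of_finrank_eq_two h2, FiniteField.pow_card, add_comm]

theorem pow_card_eq_neg_of_trace_eq_zero (h2 : Module.finrank K L = 2) {x : L}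
    (hx : Algebra.trace K L x = 0) : x ^ Fintype.card K = -x := by
  have := algebraMap_trace_of_finrank_eq_two h2 x
  rw [hx, map_zero] at this
  linear_combination -this

/-- The hypothesis `a ^ q ≠ a` says that `a` lies outside `K`. -/
theorem trace_prod_bijective (h2 : Module.finrank K L = 2) {a : L} (ha : a ^ Fintype.card K ≠ a) :
    Function.Bijective fun x : L => (Algebra.trace K L x, Algebra.trace K L (a * x)) := by
  let f : L →ₗ[K] K × K :=
    (Algebra.trace K L).prod ((Algebra.trace K L).comp (LinearMap.mulLeft K a))
  have hinj : Function.Injective f := by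
    refine (injective_iff_map_eq_zero f).2 fun x hx => ?_
    have h1 : Algebra.trace K L x = 0 := congrArg Prod.fst hx
    have h3 : Algebra.trace K L (a * x) = 0 := congrArg Prod.snd hx
    have h4 := pow_card_eq_neg_of_trace_eq_zero h2 h1
    have h5 := pow_card_eq_neg_of_trace_eq_zero h2 h3
    rw [mul_pow, h4] at h5
    by_contra hx0
    exact ha (mul_right_cancel₀ hx0 (by linear_combination -h5))
  refine (Fintype.bijective_iff_injective_and_card f).2 ⟨hinj, ?_⟩
  rw [card_eq_sq_of_finrank_eq_two h2, Fintype.card_prod, sq]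

/-- For `a ∉ K` the two traces are independent uniform elements of `K`, so the correlation of the
twisted characters is the square of a complete character sum. -/
theorem sum_quadraticChar_trace_mul [DecidableEq K] (h2 : Module.finrank K L = 2)
    (hK : ringChar K ≠ 2) {a : L} (ha : a ^ Fintype.card K ≠ a) :
    ∑ x : L, quadraticChar K (Algebra.trace K L x) * quadraticChar K (Algebra.trace K L (a * x))
      = 0 := by
  rw [(trace_prod_bijective h2 ha).sum_comp
    (fun p : K × K => quadraticChar K p.1 * quadraticChar K p.2), Fintype.sum_prod_type]
  simp_rw [← Finset.mul_sum, quadraticChar_sum_zero hK, mul_zero, Finset.sum_const_zero]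

theorem orderOf_generator (h2 : Module.finrank K L = 2) {g : Lˣ}
    (hg : ∀ x, x ∈ Subgroup.zpowers g) {n : ℕ} (hn : Fintype.card K + 1 = 4 * n) :
    (orderOf g : ℤ) = 4 * n * (Fintype.card K - 1) := by
  rw [orderOf_eq_card_of_forall_mem_zpowers hg, Nat.card_units, Nat.card_eq_fintype_card,
    card_eq_sq_of_finrank_eq_two h2, Nat.cast_sub (Nat.one_le_pow _ _ Fintype.card_pos)]
  have : (Fintype.card K : ℤ) + 1 = 4 * n := mod_cast hn
  rw [← this]; push_cast; ring

/-- The power `g ^ i` lies in `K` exactly when `q + 1 = 4 * n` divides `i`. -/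
theorem zpow_pow_card_eq_self_iff (h2 : Module.finrank K L = 2) {g : Lˣ}
    (hg : ∀ x, x ∈ Subgroup.zpowers g) {n : ℕ} (hn : Fintype.card K + 1 = 4 * n) (i : ℤ) :
    (g ^ i) ^ Fintype.card K = g ^ i ↔ (4 * n : ℤ) ∣ i := by
  have hq : (Fintype.card K : ℤ) - 1 ≠ 0 := by
    have := Fintype.one_lt_card (α := K); omega
  rw [← zpow_natCast, ← zpow_mul, ← mul_inv_eq_one, ← zpow_neg, ← zpow_add,
    ← orderOf_dvd_iff_zpow_eq_one, orderOf_generator h2 hg hn,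
    show i * (Fintype.card K : ℤ) + -i = i * (Fintype.card K - 1) by ring]
  exact mul_dvd_mul_iff_right hq

/-- The norm `g ^ (q + 1)` of a generator of `Lˣ` generates `Kˣ`, so it is not a square. -/
theorem quadraticChar_norm_generator [DecidableEq K] (h2 : Module.finrank K L = 2)
    (hK : ringChar K ≠ 2) {g : Lˣ} (hg : ∀ x, x ∈ Subgroup.zpowers g) {n : ℕ}
    (hn : Fintype.card K + 1 = 4 * n) :
    quadraticChar K (Algebra.norm K (g : L)) = -1 := by
  have hN : algebraMap K L (Algebra.norm K (g : L)) = (g : L) ^ (4 * n) := by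
    rw [algebraMap_norm_of_finrank_eq_two h2, hn]
  have hN0 : Algebra.norm K (g : L) ≠ 0 := by simp
  rw [quadraticChar_eq_neg_one_iff_not_one hN0, quadraticChar_one_iff_isSquare hN0,
    FiniteField.isSquare_iff hK hN0]
  intro h
  have h1 : g ^ (4 * n * (Fintype.card K / 2)) = 1 := by
    ext
    push_cast
    rw [pow_mul, ← hN, ← map_pow, h, map_one]
  have h3 := orderOf_dvd_iff_pow_eq_one.2 h1
  have hq := Fintype.one_lt_card (α := K)
  have hn0 : 0 < n := by omega
  zify at h3
  rw [orderOf_generator h2 hg hn, mul_dvd_mul_iff_left (by positivity)] at h3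
  have := Int.le_of_dvd (by omega) h3
  omega

theorem traceSeq_add_period [DecidableEq K] (h2 : Module.finrank K L = 2)
    (hK : ringChar K ≠ 2) {g : Lˣ} (hg : ∀ x, x ∈ Subgroup.zpowers g) {n : ℕ}
    (hn : Fintype.card K + 1 = 4 * n) (i : ℤ) :
    traceSeq K g (i + 4 * n) = -traceSeq K g i := by
  have hgi : ((g ^ (i + 4 * n) : Lˣ) : L) = Algebra.norm K (g : L) • ((g ^ i : Lˣ) : L) := by
    have h4 : (g ^ (4 * n : ℤ) : Lˣ) = g ^ (4 * n) := mod_cast zpow_natCast g (4 * n)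
    rw [zpow_add, Algebra.smul_def, algebraMap_norm_of_finrank_eq_two h2, hn, h4, Units.val_mul,
      Units.val_pow_eq_pow_val, mul_comm]
  rw [traceSeq, traceSeq, hgi, quadraticChar_trace_smul,
    quadraticChar_norm_generator h2 hK hg hn, neg_one_mul]

theorem traceSeq_add_mul_period [DecidableEq K] (h2 : Module.finrank K L = 2)
    (hK : ringChar K ≠ 2) {g : Lˣ} (hg : ∀ x, x ∈ Subgroup.zpowers g) {n : ℕ}
    (hn : Fintype.card K + 1 = 4 * n) (i m : ℤ) :
    traceSeq K g (i + 4 * n * m) = m.negOnePow * traceSeq K g i := by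
  induction m using Int.induction_on with
  | zero => simp
  | succ m ih =>
    rw [mul_add, ← add_assoc, mul_one, traceSeq_add_period h2 hK hg hn, ih, Int.negOnePow_succ]
    simp
  | pred m ih =>
    have h := traceSeq_add_period h2 hK hg hn (i + 4 * n * (-(m : ℤ) - 1))
    rw [show i + 4 * n * (-(m : ℤ) - 1) + 4 * n = i + 4 * n * (-(m : ℤ)) by ring, ih] at h
    rw [Int.negOnePow_sub, Int.negOnePow_one]
    simp only [mul_neg, mul_one, Units.val_neg]
    linarith

/-- Invariance under the Frobenius: `x` and `x ^ q` have the same trace, and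
`q * i = -i + 4 * n * i`. -/
theorem traceSeq_neg [DecidableEq K] (h2 : Module.finrank K L = 2)
    (hK : ringChar K ≠ 2) {g : Lˣ} (hg : ∀ x, x ∈ Subgroup.zpowers g) {n : ℕ}
    (hn : Fintype.card K + 1 = 4 * n) (i : ℤ) :
    traceSeq K g (-i) = i.negOnePow * traceSeq K g i := by
  have h : traceSeq K g (i * Fintype.card K) = traceSeq K g i := by
    rw [traceSeq, traceSeq, zpow_mul, zpow_natCast, Units.val_pow_eq_pow_val, trace_pow_card h2]
  have hq : (Fintype.card K : ℤ) = 4 * n - 1 := by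
    have : (Fintype.card K : ℤ) + 1 = 4 * n := mod_cast hn
    linarith
  rw [hq, show i * (4 * (n : ℤ) - 1) = -i + 4 * n * i by ring,
    traceSeq_add_mul_period h2 hK hg hn] at h
  rw [← h, ← mul_assoc, ← Units.val_mul, ← Int.negOnePow_add, Int.negOnePow_even _ ⟨i, rfl⟩]
  simp

theorem two_mul_dvd_of_traceSeq_eq_zero [DecidableEq K] (h2 : Module.finrank K L = 2) {g : Lˣ}
    (hg : ∀ x, x ∈ Subgroup.zpowers g) {n : ℕ} (hn : Fintype.card K + 1 = 4 * n) {i : ℤ}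
    (hi : traceSeq K g i = 0) : (2 * n : ℤ) ∣ i := by
  have h0 := pow_card_eq_neg_of_trace_eq_zero h2 (quadraticChar_eq_zero_iff.1 hi)
  -- A trace-zero element is negated by the Frobenius, so its square is in `K`.
  have h1 : (g ^ (i * 2)) ^ Fintype.card K = g ^ (i * 2) := by
    rw [zpow_mul, zpow_ofNat, ← pow_mul, mul_comm, pow_mul]
    ext
    rw [Units.val_pow_eq_pow_val, Units.val_pow_eq_pow_val, h0, neg_sq, Units.val_pow_eq_pow_val]
  obtain ⟨c, hc⟩ := (zpow_pow_card_eq_self_iff h2 hg hn _).1 h1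
  exact ⟨c, by linarith⟩

theorem traceSeq_zero_ne_zero [DecidableEq K] (h2 : Module.finrank K L = 2)
    (hK : ringChar K ≠ 2) (g : Lˣ) :
    traceSeq K g 0 ≠ 0 := by
  rw [traceSeq, Ne, quadraticChar_eq_zero_iff, zpow_zero, Units.val_one,
    ← map_one (algebraMap K L), Algebra.trace_algebraMap, h2]
  simpa using Ring.two_ne_zero hK

/-- The zeros of the sequence are at the odd multiples of `2 * n`; shifting by `2 * n` moves them to
the multiples of `4 * n`. -/
theorem four_mul_dvd_of_traceSeq_eq_zero [DecidableEq K] (h2 : Module.finrank K L = 2)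
    (hK : ringChar K ≠ 2) {g : Lˣ} (hg : ∀ x, x ∈ Subgroup.zpowers g) {n : ℕ}
    (hn : Fintype.card K + 1 = 4 * n) {i : ℤ}
    (hi : traceSeq K g (i + 2 * n) = 0) : (4 * n : ℤ) ∣ i := by
  obtain ⟨m, hm⟩ := two_mul_dvd_of_traceSeq_eq_zero h2 hg hn hi
  obtain ⟨r, hr | hr⟩ := Int.even_or_odd' m
  · rw [hm, hr, show 2 * (n : ℤ) * (2 * r) = 0 + 4 * n * r by ring,
      traceSeq_add_mul_period h2 hK hg hn] at hi
    simp [traceSeq_zero_ne_zero h2 hK] at hi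
  · exact ⟨r, by rw [hr] at hm; linear_combination hm⟩

/-- When `n` is odd, the exponents `8 * k + n * j + t` represent every class modulo `4 * n` exactly
once, so the corresponding powers of `g` represent every coset of `Kˣ` in `Lˣ` once. -/
theorem cosets_bijective (h2 : Module.finrank K L = 2) {g : Lˣ}
    (hg : ∀ x, x ∈ Subgroup.zpowers g) {n : ℕ} (hn : Fintype.card K + 1 = 4 * n) (hodd : Odd n)
    (t : ℤ) :
    Function.Bijective fun p : (Fin 4 × Fin n) × Kˣ =>
      Units.map (algebraMap K L).toMonoidHom p.2 * g ^ (8 * (p.1.2 : ℤ) + n * (p.1.1 : ℤ) + t) := by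
  classical
  refine (Fintype.bijective_iff_injective_and_card _).2 ⟨?_, ?_⟩
  · have hfix : ∀ c : Kˣ, (Units.map (algebraMap K L).toMonoidHom c) ^ Fintype.card K
        = Units.map (algebraMap K L).toMonoidHom c := fun c => by
      rw [← map_pow]; congr 1; ext; simp [FiniteField.pow_card]
    rintro ⟨⟨j, k⟩, c⟩ ⟨⟨j', k'⟩, c'⟩ h
    simp only at h
    have hd : (4 * n : ℤ) ∣
        (8 * (k : ℤ) + n * (j : ℤ) + t) - (8 * (k' : ℤ) + n * (j' : ℤ) + t) := by
      have he := hfix (c' / c)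
      rw [map_div, div_eq_div_iff_mul_eq_mul.2 (b := _) (h.symm.trans (mul_comm _ _)),
        div_eq_mul_inv, ← zpow_sub] at he
      exact (zpow_pow_card_eq_self_iff h2 hg hn _).1 he
    have hco : IsCoprime (4 : ℤ) n := by
      have := (Nat.coprime_two_left.2 hodd).pow_left 2
      exact_mod_cast Nat.isCoprime_iff_coprime.2 this
    have hj : j = j' := by
      have h4 : (4 : ℤ) ∣ n * ((j : ℤ) - j') := by
        obtain ⟨e, he⟩ := hd
        exact ⟨n * e - 2 * (k - k'), by linear_combination he⟩
      have := hco.dvd_of_dvd_mul_left h4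
      ext; omega
    subst hj
    have hk : k = k' := by
      have h4 : (n : ℤ) ∣ 8 * ((k : ℤ) - k') := by
        obtain ⟨e, he⟩ := hd
        exact ⟨4 * e, by linear_combination he⟩
      have := Int.eq_zero_of_abs_lt_dvd
        (hodd.isCoprime_natCast_eight.dvd_of_dvd_mul_left h4) (by rw [abs_lt]; omega)
      ext; omega
    subst hk
    have hc := Units.map_injective (algebraMap K L).injective (mul_right_cancel h)
    rw [hc]
  · have := Fintype.one_lt_card (α := K)
    simp only [Fintype.card_prod, Fintype.card_fin, Fintype.card_units]
    rw [card_eq_sq_of_finrank_eq_two h2, ← hn, ← Nat.sq_sub_sq, one_pow]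

/-- The complete sum over `L` of `sum_quadraticChar_trace_mul` is `q - 1` times this one, because
its terms are constant on the cosets of `Kˣ`. -/
theorem sum_traceSeq_mul [DecidableEq K] (h2 : Module.finrank K L = 2) (hK : ringChar K ≠ 2)
    {g : Lˣ} (hg : ∀ x, x ∈ Subgroup.zpowers g) {n : ℕ} (hn : Fintype.card K + 1 = 4 * n)
    (hodd : Odd n) (t : ℤ) {s : ℤ} (hs : ¬ (4 * n : ℤ) ∣ s) :
    ∑ j : Fin 4, ∑ k : Fin n, traceSeq K g (8 * (k : ℤ) + n * (j : ℤ) + t) *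
      traceSeq K g (8 * (k : ℤ) + n * (j : ℤ) + t + s) = 0 := by
  have ha : ((g ^ s : Lˣ) : L) ^ Fintype.card K ≠ ((g ^ s : Lˣ) : L) := by
    rw [← Units.val_pow_eq_pow_val, Ne, Units.val_inj, zpow_pow_card_eq_self_iff h2 hg hn]
    exact hs
  have h0 := sum_quadraticChar_trace_mul h2 hK ha
  have hb := cosets_bijective h2 hg hn hodd t
  rw [← Fintype.sum_of_injective (fun p => (_ : L)) (Units.val_injective.comp hb.injective)
      (fun p : (Fin 4 × Fin n) × Kˣ => traceSeq K g (8 * (p.1.2 : ℤ) + n * (p.1.1 : ℤ) + t) *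
        traceSeq K g (8 * (p.1.2 : ℤ) + n * (p.1.1 : ℤ) + t + s)) _ ?_ ?_] at h0
  · rw [Fintype.sum_prod_type_right] at h0
    simp only [Finset.sum_const, Finset.card_univ] at h0
    rw [nsmul_eq_mul, Fintype.sum_prod_type] at h0
    exact (mul_eq_zero.1 h0).resolve_left (by simp)
  · intro x hx
    by_cases hx0 : x = 0
    · simp [hx0]
    · obtain ⟨p, hp⟩ := hb.surjective (Units.mk0 x hx0)
      exact absurd ⟨p, by simp only [Function.comp_apply, hp, Units.val_mk0]⟩ hx
  · rintro ⟨⟨j, k⟩, c⟩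
    simp only [Function.comp_apply]
    generalize 8 * (k : ℤ) + n * (j : ℤ) + t = i
    have e1 : ((Units.map (algebraMap K L).toMonoidHom c * g ^ i : Lˣ) : L)
        = (c : K) • ((g ^ i : Lˣ) : L) := by
      rw [Algebra.smul_def]; rfl
    have e2 : ((g ^ s : Lˣ) : L) * ((c : K) • ((g ^ i : Lˣ) : L))
        = (c : K) • ((g ^ (i + s) : Lˣ) : L) := by
      rw [mul_smul_comm, add_comm i s, zpow_add, Units.val_mul]
    rw [e1, e2, quadraticChar_trace_smul, quadraticChar_trace_smul, traceSeq, traceSeq]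
    have := quadraticChar_sq_one c.ne_zero
    linear_combination (-(quadraticChar K (Algebra.trace K L ((g ^ i : Lˣ) : L)) *
      quadraticChar K (Algebra.trace K L ((g ^ (i + s) : Lˣ) : L)))) * this

/-- The properties of the shifted trace sequence that the construction of the quadruple uses:
negaperiodicity with period `4 * n`, the reflection rule inherited from the Frobenius, values `±1`
away from the multiples of `4 * n` (there `neg_of_even` forces a zero), and vanishing
autocorrelations at the shifts `8 * s`. A period is summed over its representatives
`8 * k + n * j`, which presupposes that `n` is odd. -/
structure IsTraceSequence (n : ℕ) (v : ℤ → ℤ) : Prop where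
  add_period : ∀ i, v (i + 4 * n) = -v i
  neg_of_even : ∀ i, Even i → v (-i) = -v i
  neg_of_odd : ∀ i, Odd i → v (-i) = v i
  dichotomy : ∀ i, ¬ (4 * n : ℤ) ∣ i → v i = 1 ∨ v i = -1
  sum_mul : ∀ s : ℤ, ¬ (n : ℤ) ∣ s →
    ∑ j : Fin 4, ∑ k : Fin n, v (8 * k + n * j) * v (8 * (k + s) + n * j) = 0

theorem isTraceSequence_traceSeq [DecidableEq K] (h2 : Module.finrank K L = 2)
    (hK : ringChar K ≠ 2) {g : Lˣ} (hg : ∀ x, x ∈ Subgroup.zpowers g) {n : ℕ}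
    (hn : Fintype.card K + 1 = 4 * n) (hodd : Odd n) :
    IsTraceSequence n fun i => traceSeq K g (i + 2 * n) := by
  have key : ∀ i : ℤ, traceSeq K g (-i + 2 * n) = -(i.negOnePow * traceSeq K g (i + 2 * n)) := by
    intro i
    rw [show -i + 2 * (n : ℤ) = -(i - 2 * n) by ring, traceSeq_neg h2 hK hg hn,
      Int.negOnePow_sub, Int.negOnePow_even (2 * n) (even_two_mul _),
      show i + 2 * (n : ℤ) = i - 2 * n + 4 * n by ring, traceSeq_add_period h2 hK hg hn]
    simp
  refine ⟨fun i => ?_, fun i hi => ?_, fun i hi => ?_, fun i hi => ?_, fun s hs => ?_⟩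
  · rw [add_right_comm, traceSeq_add_period h2 hK hg hn]
  · simp [key, Int.negOnePow_even i hi]
  · simp [key, Int.negOnePow_odd i hi]
  · exact traceSeq_ne_zero_dichotomy fun h => hi (four_mul_dvd_of_traceSeq_eq_zero h2 hK hg hn h)
  · have hs' : ¬ (4 * n : ℤ) ∣ 8 * s := fun h =>
      hs (hodd.isCoprime_natCast_eight.dvd_of_dvd_mul_left ((Dvd.intro_left 4 rfl).trans h))
    rw [← sum_traceSeq_mul h2 hK hg hn hodd (2 * n) hs']
    refine Finset.sum_congr rfl fun j _ => Finset.sum_congr rfl fun k _ => ?_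
    congr 2
    ring

end QuadraticExtension

theorem exists_isTraceSequence {n q : ℕ} (hq : IsPrimePow q) (hqn : q + 1 = 4 * n) (hodd : Odd n) :
    ∃ v, IsTraceSequence n v := by
  classical
  obtain ⟨p, m, hp, hm, rfl⟩ := (isPrimePow_nat_iff _).1 hq
  have : Fact p.Prime := ⟨hp⟩
  have := Fintype.ofFinite (GaloisField p m)
  let L := FiniteField.Extension (GaloisField p m) p 2
  have := Fintype.ofFinite L
  have hcard : Fintype.card (GaloisField p m) + 1 = 4 * n := by
    rw [← Nat.card_eq_fintype_card, GaloisField.card p m hm.ne', hqn]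
  obtain ⟨g, hg⟩ := IsCyclic.exists_generator (α := Lˣ)
  refine ⟨_, isTraceSequence_traceSeq (FiniteField.finrank_extension _ p 2) ?_ hg hcard hodd⟩
  intro h
  have := FiniteField.even_card_iff_char_two.1 h
  omega

/-! ### The GP array of a Propus quadruple -/

theorem backDiagonal_transpose (n : ℕ) : (backDiagonal n)ᵀ = backDiagonal n := by
  ext i j
  simp only [backDiagonal, Matrix.transpose_apply, Matrix.submatrix_apply, Matrix.one_apply, id]
  exact if_congr (Fin.rev_eq_iff.trans eq_comm) rfl rfl

theorem mul_backDiagonal_apply {n : ℕ} (X : Matrix (Fin n) (Fin n) ℤ) (i j : Fin n) :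
    (X * backDiagonal n) i j = X i j.rev := by
  simp [backDiagonal, Matrix.mul_apply, Matrix.one_apply, Fin.rev_eq_iff]

theorem backDiagonal_mul_apply {n : ℕ} (X : Matrix (Fin n) (Fin n) ℤ) (i j : Fin n) :
    (backDiagonal n * X) i j = X i.rev j := by
  simp [backDiagonal, Matrix.mul_apply, Matrix.one_apply]

theorem backDiagonal_mul_self (n : ℕ) : backDiagonal n * backDiagonal n = 1 := by
  ext i j
  rw [mul_backDiagonal_apply]
  simp [backDiagonal, Matrix.one_apply]

theorem backDiagonal_mul_circulant {n : ℕ} (x : Fin n → ℤ) :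
    backDiagonal n * Matrix.circulant x = (Matrix.circulant x)ᵀ * backDiagonal n := by
  ext i j
  rw [mul_backDiagonal_apply, backDiagonal_mul_apply, Matrix.transpose_apply,
    Matrix.circulant_apply, Matrix.circulant_apply]
  congr 1
  cases n with
  | zero => exact i.elim0
  | succ n =>
    rw [Fin.sub_eq_add_neg, Fin.sub_eq_add_neg, ← Fin.last_sub, ← Fin.last_sub]
    abel

theorem gpArray_apply_eq_one_or {n : ℕ} {A B C D : Matrix (Fin n) (Fin n) ℤ}
    (hA : ∀ i j, A i j = 1 ∨ A i j = -1) (hB : ∀ i j, B i j = 1 ∨ B i j = -1)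
    (hC : ∀ i j, C i j = 1 ∨ C i j = -1) (hD : ∀ i j, D i j = 1 ∨ D i j = -1)
    (i j : Fin (4 * n)) : gpArray A B C D i j = 1 ∨ gpArray A B C D i j = -1 := by
  rw [gpArray, Matrix.reindex_apply, Matrix.submatrix_apply]
  generalize finProdFinEquiv.symm i = a
  generalize finProdFinEquiv.symm j = b
  obtain ⟨a, i⟩ := a
  obtain ⟨b, j⟩ := b
  have hneg : ∀ {x : ℤ}, x = 1 ∨ x = -1 → -x = 1 ∨ -x = -1 := by omega
  rw [Matrix.comp_apply]
  fin_cases a <;> fin_cases b <;>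
    simp only [Matrix.of_apply, Matrix.cons_val, Matrix.neg_apply, mul_backDiagonal_apply,
      Matrix.transpose_apply, Fin.zero_eta, Fin.mk_one, Fin.reduceFinMk] <;>
    first
    | exact hA _ _ | exact hB _ _ | exact hC _ _ | exact hD _ _
    | exact hneg (hA _ _) | exact hneg (hB _ _) | exact hneg (hC _ _) | exact hneg (hD _ _)

/-- The `4 × 4` GP pattern over an arbitrary ring, for a quadruple `a, b, b, d`; here `b'` and `d'`
stand for the transposes of `b` and `d`, and `r` for the back-diagonal matrix. -/
def gpPattern {S : Type*} [Ring S] (a b b' d d' r : S) : Matrix (Fin 4) (Fin 4) S :=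
  !![a,     b * r,      b * r,      d * r;
     b * r, d' * r,     -a,         -(b' * r);
     b * r, -a,         -(d' * r),  b' * r;
     d * r, -(b' * r),  b' * r,     -a]

theorem gpArray_eq {n : ℕ} (A B D : Matrix (Fin n) (Fin n) ℤ) :
    gpArray A B B D = Matrix.reindex finProdFinEquiv finProdFinEquiv
      (Matrix.compRingEquiv (Fin 4) (Fin n) ℤ (gpPattern A B Bᵀ D Dᵀ (backDiagonal n))) := rfl

/-- All cross terms cancel in the square of the pattern. The hypotheses rewrite every product into
the order `a, b, b', d, d', r`. -/
theorem gpPattern_mul_self {S : Type*} [Ring S] {a b b' d d' r : S} (hr : r * r = 1)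
    (hra : r * a = a * r) (hrb : r * b = b' * r) (hrb' : r * b' = b * r)
    (hrd : r * d = d' * r) (hrd' : r * d' = d * r)
    (hba : b * a = a * b) (hba' : b' * a = a * b') (hda : d * a = a * d) (hda' : d' * a = a * d')
    (hbb : b' * b = b * b') (hdb : d * b = b * d) (hdb' : d * b' = b' * d)
    (hd'b : d' * b = b * d') (hd'b' : d' * b' = b' * d') (hdd : d' * d = d * d') :
    gpPattern a b b' d d' r * gpPattern a b b' d d' r =
      Matrix.diagonal fun _ => a * a + b * b' + b * b' + d * d' := by
  have push : ∀ {x y z w : S}, x * y = z * w → ∀ u, x * (y * u) = z * (w * u) :=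
    fun h u => by rw [← mul_assoc, h, mul_assoc]
  ext i j : 1
  fin_cases i <;> fin_cases j <;>
    simp only [gpPattern, Matrix.mul_apply, Fin.sum_univ_four, Matrix.diagonal_apply,
      Matrix.of_apply, Matrix.cons_val, Fin.zero_eta, Fin.mk_one, Fin.reduceFinMk, Fin.reduceEq,
      if_true, if_false, neg_mul, mul_neg, neg_neg, mul_assoc, push hrb, push hrb', push hrd,
      push hrd', hr, hra, mul_one, push hba, push hba', push hda, push hda', hbb, hdb, hdb', hd'b,
      hd'b', hdd] <;>
    abel

theorem gpArray_isSymm {n : ℕ} {A B D : Matrix (Fin n) (Fin n) ℤ} (hA : Aᵀ = A)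
    (hB : backDiagonal n * B = Bᵀ * backDiagonal n) (hD : backDiagonal n * D = Dᵀ * backDiagonal n)
    (hB' : backDiagonal n * Bᵀ = B * backDiagonal n)
    (hD' : backDiagonal n * Dᵀ = D * backDiagonal n) :
    (gpArray A B B D).IsSymm := by
  have h1 : ((gpPattern A B Bᵀ D Dᵀ (backDiagonal n)).map (·ᵀ))ᵀ =
      gpPattern A B Bᵀ D Dᵀ (backDiagonal n) := by
    ext a b : 1
    rw [Matrix.transpose_apply, Matrix.map_apply]
    fin_cases a <;> fin_cases b <;>
      simp only [gpPattern, Matrix.of_apply, Matrix.cons_val, Fin.zero_eta, Fin.mk_one,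
        Fin.reduceFinMk, Matrix.transpose_neg, Matrix.transpose_mul, Matrix.transpose_transpose,
        backDiagonal_transpose, hA, hB, hD, hB', hD']
  rw [Matrix.IsSymm, gpArray_eq, Matrix.transpose_reindex, Matrix.compRingEquiv_apply,
    Matrix.transpose_comp]
  congr 2

theorem transpose_circulant_mul_circulant_comm {n : ℕ} (x y : Fin n → ℤ) :
    (Matrix.circulant x)ᵀ * Matrix.circulant y = Matrix.circulant y * (Matrix.circulant x)ᵀ := by
  rw [Matrix.Fin.transpose_circulant, Matrix.Fin.circulant_mul_comm]

theorem backDiagonal_mul_transpose_circulant {n : ℕ} (x : Fin n → ℤ) :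
    backDiagonal n * (Matrix.circulant x)ᵀ = Matrix.circulant x * backDiagonal n := by
  rw [Matrix.Fin.transpose_circulant, backDiagonal_mul_circulant, Matrix.Fin.transpose_circulant]
  simp

/-- Plugging a Propus quadruple into the GP array gives a symmetric Hadamard matrix. -/
theorem IsPropusQuadruple.gpArray_isHadamard_and_isSymm {n : ℕ}
    {A B C D : Matrix (Fin n) (Fin n) ℤ} (h : IsPropusQuadruple A B C D) :
    (gpArray A B C D).IsHadamard ∧ (gpArray A B C D).IsSymm := by
  have hpm : ∀ {X : Matrix (Fin n) (Fin n) ℤ},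
      IsBinaryCirculant X → ∀ i j, X i j = 1 ∨ X i j = -1 :=
    fun ⟨_, hx, e⟩ i j => by rw [e]; exact hx _
  have hentry := gpArray_apply_eq_one_or (hpm h.circulant_A) (hpm h.circulant_B)
    (hpm h.circulant_C) (hpm h.circulant_D)
  have hsum := h.sum_mul_transpose
  have hA := h.symm_A
  obtain rfl := h.B_eq_C
  obtain ⟨a, -, rfl⟩ := h.circulant_A
  obtain ⟨b, -, rfl⟩ := h.circulant_B
  obtain ⟨d, -, rfl⟩ := h.circulant_D
  have hsymm : (gpArray (Matrix.circulant a) (Matrix.circulant b) (Matrix.circulant b)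
      (Matrix.circulant d)).IsSymm :=
    gpArray_isSymm hA (backDiagonal_mul_circulant b) (backDiagonal_mul_circulant d)
      (backDiagonal_mul_transpose_circulant b) (backDiagonal_mul_transpose_circulant d)
  have hsq := gpPattern_mul_self (backDiagonal_mul_self n)
    ((backDiagonal_mul_circulant a).trans (by rw [hA]))
    (backDiagonal_mul_circulant b) (backDiagonal_mul_transpose_circulant b)
    (backDiagonal_mul_circulant d) (backDiagonal_mul_transpose_circulant d)
    (Matrix.Fin.circulant_mul_comm b a) (transpose_circulant_mul_circulant_comm b a)
    (Matrix.Fin.circulant_mul_comm d a) (transpose_circulant_mul_circulant_comm d a)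
    (transpose_circulant_mul_circulant_comm b b) (Matrix.Fin.circulant_mul_comm d b)
    (transpose_circulant_mul_circulant_comm b d).symm (transpose_circulant_mul_circulant_comm d b)
    (by rw [← Matrix.transpose_mul, Matrix.Fin.circulant_mul_comm, Matrix.transpose_mul])
    (transpose_circulant_mul_circulant_comm d d)
  rw [hA] at hsum
  rw [hsum] at hsq
  have hmul : gpArray (Matrix.circulant a) (Matrix.circulant b) (Matrix.circulant b)
      (Matrix.circulant d) * (gpArray (Matrix.circulant a) (Matrix.circulant b)
      (Matrix.circulant b) (Matrix.circulant d)) = (4 * n : ℤ) • 1 := by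
    rw [gpArray_eq, Matrix.reindex_apply, Matrix.submatrix_mul_equiv, ← map_mul, hsq, zsmul_one,
      ← Pi.intCast_def, Matrix.diagonal_intCast', map_intCast, ← zsmul_one,
      Matrix.submatrix_smul, Pi.smul_apply, Pi.smul_apply,
      Matrix.submatrix_one_equiv]
  have hconj : ∀ M : Matrix (Fin (4 * n)) (Fin (4 * n)) ℤ, Mᴴ = Mᵀ := fun M => by
    ext; simp
  refine ⟨⟨fun i j => ?_, ?_, ?_⟩, hsymm⟩
  · rcases hentry i j with e | e <;> rw [e]
    · exact one_mem _
    · exact Unitary.mem_iff_eq_one_or_eq_neg_one.2 (Or.inr rfl)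
  all_goals
    rw [hconj, hsymm.eq, hmul]
    simp

/-! ### Circulants of periodic sequences -/

section PeriodicCirculant

variable {n : ℕ} {f : ℤ → ℤ}

theorem Function.Periodic.map_fin_sub (hf : Function.Periodic f n) (i j : Fin n) :
    f ((i - j : Fin n) : ℕ) = f (i - j) := by
  rw [Fin.intCast_val_sub_eq_sub_add_ite]
  split_ifs
  · simp
  · exact hf _

theorem Function.Periodic.sum_fin_sub (hf : Function.Periodic f n) (i : Fin n) :
    ∑ k : Fin n, f (i - k) = ∑ k : Fin n, f k := by
  have : NeZero n := ⟨by rintro rfl; exact i.elim0⟩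
  rw [← (Equiv.subLeft i).sum_comp fun k : Fin n => f k]
  exact Finset.sum_congr rfl fun k _ => (hf.map_fin_sub i k).symm

theorem circulant_mul_transpose_apply (hf : Function.Periodic f n) (i l : Fin n) :
    (Matrix.circulant (fun k : Fin n => f k) * (Matrix.circulant fun k : Fin n => f k)ᵀ) i l =
      ∑ k : Fin n, f k * f (k + (l - i)) := by
  have hF : Function.Periodic (fun k => f k * f (k + (l - i))) n := fun k => by
    simp only [add_right_comm k (n : ℤ), hf _]
  rw [← hF.sum_fin_sub i, Matrix.mul_apply]
  refine Finset.sum_congr rfl fun k _ => ?_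
  rw [Matrix.transpose_apply, Matrix.circulant_apply, Matrix.circulant_apply, hf.map_fin_sub,
    hf.map_fin_sub]
  congr 2
  ring

theorem IsBinaryCirculant.mul_transpose_apply_self {X : Matrix (Fin n) (Fin n) ℤ}
    (hX : IsBinaryCirculant X) (i : Fin n) : (X * Xᵀ) i i = n := by
  obtain ⟨x, hx, rfl⟩ := hX
  have hsq : ∀ k, x k * x k = 1 := fun k => by
    rcases hx k with h | h <;> rw [h] <;> rfl
  simp [Matrix.mul_apply, hsq]

end PeriodicCirculant

/-! ### The quadruple attached to a trace sequence -/

/-- The circulant of order `n` formed by the values of `v` on the residues `8 * k + n * j`. For odd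
`n`, the values `j = 0, 1, 2, 3` together cover the residues modulo `4 * n`. -/
def residueCirculant (n : ℕ) (v : ℤ → ℤ) (j : ℤ) : Matrix (Fin n) (Fin n) ℤ :=
  Matrix.circulant fun k : Fin n => v (8 * k + n * j)

namespace IsTraceSequence

variable {n : ℕ} {v : ℤ → ℤ}

theorem periodic_residue (hv : IsTraceSequence n v) (j : ℤ) :
    Function.Periodic (fun k => v (8 * k + n * j)) n := fun k => by
  simp only
  rw [show 8 * (k + (n : ℤ)) + n * j = 8 * k + n * j + 4 * n + 4 * n by ring,
    hv.add_period, hv.add_period, neg_neg]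

theorem residueCirculant_apply (hv : IsTraceSequence n v) (j : ℤ) (i k : Fin n) :
    residueCirculant n v j i k = v (8 * (i - k) + n * j) :=
  (hv.periodic_residue j).map_fin_sub i k

theorem residueCirculant_zero_transpose (hv : IsTraceSequence n v) :
    (residueCirculant n v 0)ᵀ = -residueCirculant n v 0 := by
  ext i k
  rw [Matrix.transpose_apply, Matrix.neg_apply, hv.residueCirculant_apply,
    hv.residueCirculant_apply, ← hv.neg_of_even _ ⟨4 * (i - k), by ring⟩]
  congr 1
  ring

theorem residueCirculant_one_transpose (hv : IsTraceSequence n v) (hodd : Odd n) :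
    (residueCirculant n v 1)ᵀ = -residueCirculant n v 3 := by
  ext i k
  obtain ⟨m, hm⟩ := hodd
  have hm' : (n : ℤ) = 2 * m + 1 := mod_cast hm
  rw [Matrix.transpose_apply, Matrix.neg_apply, hv.residueCirculant_apply,
    hv.residueCirculant_apply,
    show 8 * ((i : ℤ) - k) + (n : ℤ) * 3 = -(8 * (k - i) + n * 1) + 4 * n by ring,
    hv.add_period, hv.neg_of_odd _ ⟨4 * (k - i) + m, by linear_combination hm'⟩, neg_neg]

theorem residueCirculant_two_transpose (hv : IsTraceSequence n v) :
    (residueCirculant n v 2)ᵀ = residueCirculant n v 2 := by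
  ext i k
  rw [Matrix.transpose_apply, hv.residueCirculant_apply, hv.residueCirculant_apply,
    show 8 * ((i : ℤ) - k) + (n : ℤ) * 2 = -(8 * (k - i) + n * 2) + 4 * n by ring,
    hv.add_period, hv.neg_of_even _ ⟨4 * (k - i) + n, by ring⟩, neg_neg]

/-- The circulants for `j = 1` and `j = 3` are negative transposes of each other, so they have the
same Gram matrix; this is what allows the quadruple to contain one of them twice. -/
theorem residueCirculant_one_mul_transpose (hv : IsTraceSequence n v) (hodd : Odd n) :
    residueCirculant n v 1 * (residueCirculant n v 1)ᵀ =
      residueCirculant n v 3 * (residueCirculant n v 3)ᵀ := by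
  rw [← neg_neg (residueCirculant n v 3), ← hv.residueCirculant_one_transpose hodd,
    Matrix.transpose_neg, neg_mul_neg, Matrix.transpose_transpose]
  exact (transpose_circulant_mul_circulant_comm _ _).symm

theorem residue_dichotomy (hv : IsTraceSequence n v) (hodd : Odd n) {j : ℤ} {k : Fin n}
    (h : ¬ ((k : ℕ) = 0 ∧ (4 : ℤ) ∣ j)) : v (8 * k + n * j) = 1 ∨ v (8 * k + n * j) = -1 := by
  refine hv.dichotomy _ fun ⟨e, he⟩ => h ?_
  have hk : (n : ℤ) ∣ k := hodd.isCoprime_natCast_eight.dvd_of_dvd_mul_left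
    ⟨4 * e - j, by linear_combination he⟩
  have hk0 : (k : ℕ) = 0 := Nat.eq_zero_of_dvd_of_lt (Int.natCast_dvd_natCast.1 hk) k.isLt
  refine ⟨hk0, e, ?_⟩
  have hn : (n : ℤ) ≠ 0 := by have := k.isLt; omega
  rw [hk0] at he
  apply mul_left_cancel₀ hn
  linear_combination he

theorem isBinaryCirculant_residueCirculant (hv : IsTraceSequence n v) (hodd : Odd n) {j : ℤ}
    (hj : ¬ (4 : ℤ) ∣ j) : IsBinaryCirculant (residueCirculant n v j) :=
  ⟨_, fun _ => hv.residue_dichotomy hodd fun h => hj h.2, rfl⟩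

theorem isBinaryCirculant_one_add_residueCirculant_zero (hv : IsTraceSequence n v)
    (hodd : Odd n) : IsBinaryCirculant (1 + residueCirculant n v 0) := by
  have hv0 : v 0 = 0 := by
    have := hv.neg_of_even 0 (by simp)
    rw [neg_zero] at this
    omega
  refine ⟨(fun i : Fin n => if (i : ℕ) = 0 then 1 else 0) + fun k : Fin n => v (8 * k + n * 0),
    fun k => ?_, ?_⟩
  · by_cases hk : (k : ℕ) = 0
    · simp [hk, hv0]
    · simpa [hk] using hv.residue_dichotomy hodd (j := 0) (k := k) fun h => hk h.1
  · rw [Matrix.circulant_add, Matrix.Fin.circulant_ite, residueCirculant]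

/-- The sum of the four Gram matrices vanishes off the diagonal. -/
theorem sum_residueCirculant_mul_transpose_apply (hv : IsTraceSequence n v) {i l : Fin n}
    (hil : i ≠ l) :
    ∑ j : Fin 4, (residueCirculant n v (j : ℕ) * (residueCirculant n v (j : ℕ))ᵀ) i l = 0 := by
  have hs : ¬ (n : ℤ) ∣ (l : ℤ) - i := fun h => hil <| by
    have := Int.eq_zero_of_abs_lt_dvd h (by rw [abs_lt]; omega)
    ext; omega
  rw [← hv.sum_mul _ hs]
  exact Finset.sum_congr rfl fun j _ => circulant_mul_transpose_apply (hv.periodic_residue _) i l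

theorem exists_quadruple (hv : IsTraceSequence n v) (hodd : Odd n) :
    ∃ A B C D : Matrix (Fin n) (Fin n) ℤ, IsGoethalsSeidelQuadruple A B C D ∧
      (1 - A)ᵀ = -1 + A ∧ Bᵀ = B ∧ C = D := by
  have hb0 := hv.isBinaryCirculant_one_add_residueCirculant_zero hodd
  have hb1 := hv.isBinaryCirculant_residueCirculant hodd (j := 1) (by norm_num)
  have hb2 := hv.isBinaryCirculant_residueCirculant hodd (j := 2) (by norm_num)
  refine ⟨_, _, _, _, ⟨hb0, hb2, hb1, hb1, ?_⟩, ?_, hv.residueCirculant_two_transpose, rfl⟩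
  · ext i l
    by_cases hil : i = l
    · -- The diagonal entries need no character sums, since all entries of the blocks are `±1`.
      subst hil
      simp only [Matrix.add_apply, hb0.mul_transpose_apply_self, hb1.mul_transpose_apply_self,
        hb2.mul_transpose_apply_self, Matrix.smul_apply, Matrix.one_apply_eq, smul_eq_mul]
      ring
    · have hA : (1 + residueCirculant n v 0) * (1 + residueCirculant n v 0)ᵀ =
          1 + residueCirculant n v 0 * (residueCirculant n v 0)ᵀ := by
        rw [Matrix.transpose_add, Matrix.transpose_one, hv.residueCirculant_zero_transpose]
        noncomm_ring
      have h0 := hv.sum_residueCirculant_mul_transpose_apply hil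
      have h1 := congrFun₂ (hv.residueCirculant_one_mul_transpose hodd) i l
      simp only [Fin.sum_univ_four, Fin.val_zero, Fin.val_one, Fin.val_two, Nat.cast_zero,
        Nat.cast_one, Nat.cast_ofNat, show ((3 : Fin 4) : ℕ) = 3 from rfl] at h0
      rw [hA, Matrix.add_apply, Matrix.add_apply, Matrix.add_apply, Matrix.add_apply,
        Matrix.smul_apply, Matrix.one_apply_ne hil, smul_zero]
      linear_combination h0 + h1
  · rw [Matrix.transpose_sub, Matrix.transpose_add, Matrix.transpose_one,
      hv.residueCirculant_zero_transpose]
    abel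

end IsTraceSequence

/-! ### Existence of the symmetric Hadamard matrix -/

theorem theorem5 (n q : ℕ) (hq : IsPrimePow q) (hqn : q + 1 = 4 * n) (hq8 : q ≡ 3 [MOD 8]) :
    ∃ A B C D : Matrix (Fin n) (Fin n) ℤ,
      IsGoethalsSeidelQuadruple A B C D ∧
      (1 - A)ᵀ = -1 + A ∧ Bᵀ = B ∧ C = D ∧
      IsPropusQuadruple B C D A ∧
      (gpArray B C D A).IsHadamard ∧ (gpArray B C D A).IsSymm := by
  have hodd : Odd n := by
    rw [Nat.odd_iff]
    have : q % 8 = 3 := hq8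
    omega
  obtain ⟨v, hv⟩ := exists_isTraceSequence hq hqn hodd
  obtain ⟨A, B, C, D, h, hA, hB, hCD⟩ := hv.exists_quadruple hodd
  have hprop : IsPropusQuadruple B C D A :=
    { circulant_A := h.circulant_B
      circulant_B := h.circulant_C
      circulant_C := h.circulant_D
      circulant_D := h.circulant_A
      sum_mul_transpose := by rw [← h.sum_mul_transpose]; abel
      symm_A := hB
      B_eq_C := hCD }
  exact ⟨A, B, C, D, h, hA, hB, hCD, hprop, hprop.gpArray_isHadamard_and_isSymm⟩
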